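/- Scalars are real or complex, and "subspace" of a Banach space means closed linear subspace. Let $E$ be an M-embedded Banach space, i.e. the annihilator of (the canonical image of) $E$ in $E'''$ is the range of a bounded linear projection $P$ on $E'''$ satisfying $\|f\|=\|Pf\|+\|f-Pf\|$ for all $f\in E'''$. Let $Y$ be a nonreflexive closed subspace of $E$. Then: (1) $Y$ contains an asymptotically isometric copy of $c_0$: there is a closed subspace $W\subseteq Y$ with a Schauder basis $(x_n)_{n\ge 1}$ and a sequence $(\delta_n)$ in $[0,1)$ tending to $0$ such that $$\max_{n\le m}(1-\delta_n)|\alpha_n|\;\le\;\Big\|\sum_{n=1}^m\alpha_n x_n\Big\|\;\le\;\max_{n\le m}(1+\delta_n)|\alpha_n|$$ for all $m\ge 1$ and all scalars $\alpha_1,\dots,\alpha_m$. (2) $Y$ fails the fixed point property: there are a nonempty closed bounded convex set $C\subset Y$ and a map $f:C\to C$ with $\|f(x)-f(y)\|<\|x-y\|$ for all $x\ne y$ in $C$ which has no fixed point. -/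

import Mathlib

open Filter Topology

section Notions

variable (𝕜 : Type*) [RCLike 𝕜]

/-- A subspace `J` of a normed space `X` is an M-ideal in `X` if its annihilator
`{f ∈ X' | ∀ x ∈ J, f x = 0}` is the range of an L-projection on the dual `X'`, i.e. of a bounded
linear projection `P` with `‖f‖ = ‖P f‖ + ‖f - P f‖` for all `f`. -/
def IsMIdeal {X : Type*} [NormedAddCommGroup X] [NormedSpace 𝕜 X] (J : Submodule 𝕜 X) : Prop :=
  ∃ P : StrongDual 𝕜 X →L[𝕜] StrongDual 𝕜 X,
    IsLprojection (StrongDual 𝕜 X) P ∧ P.range = StrongDual.polarSubmodule 𝕜 J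

/-- `X` is M-embedded if (the canonical image of) `X` is an M-ideal in its bidual. -/
def IsMEmbedded (X : Type*) [NormedAddCommGroup X] [NormedSpace 𝕜 X] : Prop :=
  IsMIdeal 𝕜 (X := StrongDual 𝕜 (StrongDual 𝕜 X)) (NormedSpace.inclusionInDoubleDual 𝕜 X).range

/-- `X` is reflexive if the canonical embedding of `X` into its bidual is onto. -/
def IsReflexiveSpace (X : Type*) [NormedAddCommGroup X] [NormedSpace 𝕜 X] : Prop :=
  Function.Surjective (NormedSpace.inclusionInDoubleDual 𝕜 X)

/-- `x 0, x 1, …` spans `c₀` asymptotically isometrically: for some `δ n ∈ [0, 1)` tending to `0`,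
`max_{n ≤ m} (1 - δ n) |α n| ≤ ‖∑_{n ≤ m} α n • x n‖ ≤ max_{n ≤ m} (1 + δ n) |α n|`
for all `m` and all scalars `α n`. -/
def SpansC0Asymptotically {X : Type*} [NormedAddCommGroup X] [NormedSpace 𝕜 X]
    (x : ℕ → X) : Prop :=
  ∃ δ : ℕ → ℝ, (∀ n, 0 ≤ δ n ∧ δ n < 1) ∧ Tendsto δ atTop (𝓝 0) ∧
    ∀ (m : ℕ) (α : ℕ → 𝕜),
      (Finset.range (m + 1)).sup' Finset.nonempty_range_add_one (fun n => (1 - δ n) * ‖α n‖)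
          ≤ ‖∑ n ∈ Finset.range (m + 1), α n • x n‖ ∧
      ‖∑ n ∈ Finset.range (m + 1), α n • x n‖
          ≤ (Finset.range (m + 1)).sup' Finset.nonempty_range_add_one
              (fun n => (1 + δ n) * ‖α n‖)

/-- `X` is asymptotically isometric to `c₀`: it has a Schauder basis which spans `c₀`
asymptotically isometrically. -/
def IsAsymptoticallyIsometricToC0 (X : Type*) [NormedAddCommGroup X] [NormedSpace 𝕜 X] : Prop :=
  ∃ b : SchauderBasis 𝕜 X, SpansC0Asymptotically 𝕜 (fun n => b n)

/-- The subspace `Y` contains an asymptotically isometric copy of `c₀`: it has a closed subspace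
(closed in the ambient space) which is asymptotically isometric to `c₀`. -/
def ContainsAsymptoticC0Copy {X : Type*} [NormedAddCommGroup X] [NormedSpace 𝕜 X]
    (Y : Submodule 𝕜 X) : Prop :=
  ∃ W : Submodule 𝕜 X, W ≤ Y ∧ IsClosed (W : Set X) ∧ IsAsymptoticallyIsometricToC0 𝕜 W

end Notions

/-- The fixed point property: every contractive self-map of a nonempty closed bounded convex
set `C` has a fixed point, where `f` is contractive if `‖f x - f y‖ < ‖x - y‖` for all distinct
`x, y ∈ C`. -/
def HasFixedPointProperty (X : Type*) [NormedAddCommGroup X] [NormedSpace ℝ X] : Prop :=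
  ∀ C : Set X, C.Nonempty → IsClosed C → Bornology.IsBounded C → Convex ℝ C →
    ∀ f : C → C, (∀ x y : C, x ≠ y → ‖(f x : X) - (f y : X)‖ < ‖(x : X) - (y : X)‖) →
      ∃ x : C, f x = x

/-!
The L-projection of an M-embedded space `E` is the canonical one: a functional on `E''` whose norm
is minimal among the functionals with the same restriction to `E` lies in the kernel of the
projection (`IsMIdeal.norm_add_norm_sub_le`), and the image of `E'` in `E'''` consists of such
functionals. So the norm of `F` in `E'''` is the sum of the norms of its restriction to `E`,
viewed in `E'''`, and of the remainder. This identity restricts to every subspace `Y` because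
`Y''` sits isometrically in `E''` (`HasCanonicalLDecomposition.submodule`). From here on only `Y`
matters.

By Hahn–Banach duality in finite powers, the `ℓ¹`-decomposition of `Y'''` gives a restricted ball
property: a point of the unit ball of `Y''` can be moved by an element of `Y` so that its sums
with finitely many given points of the ball of `Y` have norm almost at most one. When `Y` is not
reflexive, Riesz's lemma provides a point of the unit sphere of `Y''` almost at distance one from
`Y`, and the moved point still has norm almost one. Helly's theorem replaces it by an element of
`Y`, so that each finite dimensional subspace `F` of `Y` admits an `x` for which `‖y + a x‖` is
`max ‖y‖ ‖a‖` up to a factor between `1 - ε` and `1 + ε`, for all `y` in `F` and all scalars `a`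
(`HasCanonicalLDecomposition.exists_norm_add_smul_mem`).
Choosing such vectors inductively, with the errors of each step as small as desired, yields a
sequence with `c₀`-estimates for any prescribed strictly decreasing `δ`
(`HasCanonicalLDecomposition.exists_hasC0Estimates`); it is a Schauder basis of its closed span.

Since the `δ n` can be prescribed, weights `γ n ≥ 1` can be found that decrease fast in comparison
with them. On the convex set of the elements with `n`-th coordinate in `[0, γ n]`, the weighted
right shift that inserts `γ 0` in front is then contractive, and its only candidate for a fixed
point, with coordinates `γ n`, does not belong to the space
(`HasC0Estimates.not_hasFixedPointProperty`).
-/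

/-! ### Hahn–Banach duality in finite powers -/

section Duality

variable {𝕜 : Type*} [RCLike 𝕜]

/-- Hahn–Banach duality for the distance to a subspace: `v` is almost within `r` of `S` as soon as
every functional of norm at most one that vanishes on `S` is at most `r` at `v`. -/
theorem exists_mem_norm_sub_lt_of_forall_dual {X : Type*} [NormedAddCommGroup X] [NormedSpace 𝕜 X]
    (S : Submodule 𝕜 X) (v : X) {r : ℝ}
    (h : ∀ f : StrongDual 𝕜 X, ‖f‖ ≤ 1 → (∀ s ∈ S, f s = 0) → ‖f v‖ ≤ r) {ε : ℝ} (hε : 0 < ε) :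
    ∃ s ∈ S, ‖v - s‖ < r + ε := by
  obtain ⟨g, hg1, hgv⟩ := exists_dual_vector'' 𝕜 (S.mkQ v)
  have hle : ∀ x, ‖S.mkQ x‖ ≤ ‖x‖ := fun x => Submodule.Quotient.norm_mk_le S x
  let q : X →L[𝕜] (X ⧸ S) := S.mkQ.mkContinuous 1 (by simpa using hle)
  have hqv : ‖S.mkQ v‖ ≤ r := by
    have hq : ‖g.comp q‖ ≤ 1 := by
      refine ContinuousLinearMap.opNorm_le_bound _ zero_le_one fun x => ?_
      calc ‖g (S.mkQ x)‖ ≤ ‖g‖ * ‖S.mkQ x‖ := g.le_opNorm _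
        _ ≤ 1 * ‖x‖ := by gcongr; exact hle x
    have := h (g.comp q) hq fun s hs => by
      change g (S.mkQ s) = 0
      rw [(Submodule.Quotient.mk_eq_zero S).2 hs |> fun h => (h : S.mkQ s = 0), map_zero]
    change ‖g (S.mkQ v)‖ ≤ r at this
    rw [hgv] at this
    simpa using this
  obtain ⟨m, hm, hmn⟩ := Submodule.Quotient.norm_mk_lt (S := S) (S.mkQ v) hε
  refine ⟨v - m, (Submodule.Quotient.eq S).1 hm.symm, ?_⟩
  rw [sub_sub_cancel]
  linarith

/-- The components of a functional on a finite sup-normed power have norms summing to at most its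
norm. -/
theorem sum_norm_comp_single_le {ι : Type*} [Fintype ι] [DecidableEq ι] {X : Type*}
    [NormedAddCommGroup X] [NormedSpace 𝕜 X] (f : StrongDual 𝕜 (ι → X)) :
    ∑ i, ‖f.comp (ContinuousLinearMap.single 𝕜 (fun _ : ι => X) i)‖ ≤ ‖f‖ := by
  set g : ι → StrongDual 𝕜 X := fun i => f.comp (ContinuousLinearMap.single 𝕜 (fun _ => X) i)
  refine le_of_forall_pos_sub_le fun ε hε => ?_
  obtain ⟨η, hη, hηε⟩ : ∃ η > 0, Fintype.card ι * η ≤ ε := by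
    refine ⟨ε / (Fintype.card ι + 1), by positivity, ?_⟩
    rw [mul_div_assoc', div_le_iff₀ (by positivity)]
    nlinarith
  -- Norm-almost-attaining vectors, rotated so that no cancellation occurs in `∑ i, g i (u i)`.
  have : ∀ i, ∃ u : X, ‖u‖ ≤ 1 ∧ ∃ t : ℝ, g i u = t ∧ ‖g i‖ - η ≤ t := by
    intro i
    obtain ⟨x, hx, hgx⟩ := (g i).exists_lt_apply_of_lt_opNorm (r := ‖g i‖ - η) (by linarith)
    obtain ⟨c, hc, hcx⟩ := RCLike.exists_norm_eq_mul_self (g i x)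
    refine ⟨c • x, by rw [norm_smul, hc, one_mul]; exact hx.le, ‖g i x‖, ?_, hgx.le⟩
    rw [map_smul, smul_eq_mul, ← hcx]
  choose u hu t hgt ht using this
  have hfu : f u = ((∑ i, t i : ℝ) : 𝕜) := by
    have hsum : u = ∑ i, ContinuousLinearMap.single 𝕜 (fun _ : ι => X) i (u i) := by
      simpa using (Finset.univ_sum_single u).symm
    rw [hsum, map_sum]
    push_cast
    exact Finset.sum_congr rfl fun i _ => hgt i
  have hle : ∑ i, t i ≤ ‖f‖ := by
    calc ∑ i, t i ≤ ‖f u‖ := by rw [hfu, RCLike.norm_ofReal]; exact le_abs_self _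
      _ ≤ ‖f‖ * ‖u‖ := f.le_opNorm u
      _ ≤ ‖f‖ := mul_le_of_le_one_right (norm_nonneg _)
          ((pi_norm_le_iff_of_nonneg zero_le_one).2 hu)
  have hsum : ∑ i, (‖g i‖ - η) ≤ ∑ i, t i := Finset.sum_le_sum fun i _ => ht i
  rw [Finset.sum_sub_distrib, Finset.sum_const, Finset.card_univ, nsmul_eq_mul] at hsum
  linarith

/-- Simultaneous approximation: the distance of a finite tuple to the range of a linear map is
controlled by the tuples of functionals annihilating that range. -/
theorem exists_forall_norm_sub_lt_of_forall_dual {ι : Type*} [Fintype ι] {X J : Type*}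
    [NormedAddCommGroup X] [NormedSpace 𝕜 X] [AddCommGroup J] [Module 𝕜 J]
    (T : J →ₗ[𝕜] (ι → X)) (v : ι → X) {r : ℝ} (hr : 0 ≤ r)
    (h : ∀ f : ι → StrongDual 𝕜 X, (∀ j, ∑ i, f i (T j i) = 0) →
      ‖∑ i, f i (v i)‖ ≤ r * ∑ i, ‖f i‖) {ε : ℝ} (hε : 0 < ε) :
    ∃ j, ∀ i, ‖v i - T j i‖ < r + ε := by
  classical
  obtain ⟨s, ⟨j, rfl⟩, hs⟩ := exists_mem_norm_sub_lt_of_forall_dual (LinearMap.range T) v (r := r)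
    (fun f hf hfT => by
      have key : ∀ w : ι → X,
          f w = ∑ i, f.comp (ContinuousLinearMap.single 𝕜 (fun _ : ι => X) i) (w i) := by
        intro w
        have hsum : w = ∑ i, ContinuousLinearMap.single 𝕜 (fun _ : ι => X) i (w i) := by
          simpa using (Finset.univ_sum_single w).symm
        conv_lhs => rw [hsum, map_sum]
        rfl
      have := h (fun i => f.comp (ContinuousLinearMap.single 𝕜 (fun _ : ι => X) i))
        (fun j => by rw [← key]; exact hfT _ ⟨j, rfl⟩)
      rw [← key] at this
      exact this.trans (mul_le_of_le_one_right hr ((sum_norm_comp_single_le f).trans hf))) hε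
  exact ⟨j, fun i => (norm_le_pi_norm (v - T j) i).trans_lt hs⟩

end Duality

/-! ### The canonical decomposition of the third dual -/

section Bidual

open NormedSpace

/-- A shortcut that lets instance search reach the third dual. -/
noncomputable local instance dualNormedAddCommGroup {𝕜 B : Type*} [RCLike 𝕜]
    [NormedAddCommGroup B] [NormedSpace 𝕜 B] : NormedAddCommGroup (StrongDual 𝕜 B) :=
  inferInstance

/-- A shortcut that lets instance search reach the third dual. -/
noncomputable local instance dualNormedSpace {𝕜 B : Type*} [RCLike 𝕜]
    [NormedAddCommGroup B] [NormedSpace 𝕜 B] : NormedSpace 𝕜 (StrongDual 𝕜 B) :=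
  inferInstance

variable {𝕜 : Type*} [RCLike 𝕜] {Y : Type*} [NormedAddCommGroup Y] [NormedSpace 𝕜 Y]

variable (𝕜 Y) in
/-- The canonical decomposition `Y''' = Y' ⊕ Y^⊥`, which splits `F` into (the image of) its
restriction to `Y` and the rest, is an `ℓ¹`-sum. Only the nontrivial inequality is recorded. -/
def HasCanonicalLDecomposition : Prop :=
  ∀ F : StrongDual 𝕜 (StrongDual 𝕜 (StrongDual 𝕜 Y)),
    ‖F.comp (inclusionInDoubleDual 𝕜 Y)‖ +
      ‖F - inclusionInDoubleDual 𝕜 (StrongDual 𝕜 Y) (F.comp (inclusionInDoubleDual 𝕜 Y))‖ ≤ ‖F‖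

/-- The restricted ball property of an M-embedded space in its bidual: a point `x` of the bidual
ball can be translated by an element of `Y` so that it becomes almost orthogonal, in the sense of
`ℓ^∞`-sums, to finitely many given elements of the ball of `Y`. -/
theorem HasCanonicalLDecomposition.exists_forall_norm_add_sub_lt
    (H : HasCanonicalLDecomposition 𝕜 Y) {ι : Type*} [Fintype ι] (y : ι → Y) (hy : ∀ i, ‖y i‖ ≤ 1)
    (x : StrongDual 𝕜 (StrongDual 𝕜 Y)) (hx : ‖x‖ ≤ 1) {ε : ℝ} (hε : 0 < ε) :
    ∃ z : Y, ∀ i, ‖x + inclusionInDoubleDual 𝕜 Y (y i) - inclusionInDoubleDual 𝕜 Y z‖ < 1 + ε := by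
  refine exists_forall_norm_sub_lt_of_forall_dual
    (LinearMap.pi fun _ : ι => (inclusionInDoubleDual 𝕜 Y).toLinearMap)
    (fun i => x + inclusionInDoubleDual 𝕜 Y (y i)) zero_le_one (fun F hF => ?_) hε
  set R : ι → StrongDual 𝕜 Y := fun i => (F i).comp (inclusionInDoubleDual 𝕜 Y)
  have hR : ∑ i, R i = 0 := by
    ext z
    simpa [R] using hF z
  have hxR : ∑ i, x (R i) = 0 := by rw [← map_sum, hR, map_zero]
  have hsum : ∑ i, F i (x + inclusionInDoubleDual 𝕜 Y (y i)) =
      ∑ i, ((F i - inclusionInDoubleDual 𝕜 (StrongDual 𝕜 Y) (R i)) x + R i (y i)) := by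
    rw [← sub_eq_zero, ← Finset.sum_sub_distrib, ← hxR]
    refine Finset.sum_congr rfl fun i _ => ?_
    simp [R]
  rw [hsum, one_mul]
  refine norm_sum_le_of_le _ fun i _ => ?_
  refine (norm_add_le _ _).trans ?_
  refine le_trans ?_ (H (F i))
  rw [add_comm]
  gcongr
  · exact ContinuousLinearMap.le_of_opNorm_le_of_le _ le_rfl (hy i) |>.trans (by rw [mul_one])
  · exact ContinuousLinearMap.le_of_opNorm_le_of_le _ le_rfl hx |>.trans (by rw [mul_one])

/-- A form of Helly's theorem: finitely many norm inequalities and one functional equation solved in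
the bidual can be solved approximately in the space. -/
theorem exists_forall_norm_add_lt_and_norm_apply_sub_lt {ι : Type*} [Fintype ι] (y : ι → Y)
    (z : StrongDual 𝕜 (StrongDual 𝕜 Y)) (φ : StrongDual 𝕜 Y) {r : ℝ} (hr : 0 ≤ r)
    (hz : ∀ i, ‖z + inclusionInDoubleDual 𝕜 Y (y i)‖ ≤ r) {ε : ℝ} (hε : 0 < ε) :
    ∃ x : Y, ∀ i, ‖x + y i‖ < r + ε ∧ ‖φ x - z φ‖ < ε := by
  -- The functional equation is weighted by a large constant `c`, at no cost to the bound `r`.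
  obtain ⟨c, hc, hcr⟩ : ∃ c : ℝ, 0 < c ∧ r + ε = c * ε :=
    ⟨(r + ε) / ε, by positivity, by field_simp⟩
  let T : Y →ₗ[𝕜] (ι → Y × 𝕜) :=
    LinearMap.pi fun _ => LinearMap.prod (-LinearMap.id) (-((c : 𝕜) • φ.toLinearMap))
  have hT : ∀ u i, T u i = (-u, -((c : 𝕜) * φ u)) := fun u i => rfl
  obtain ⟨x, hx⟩ := exists_forall_norm_sub_lt_of_forall_dual T
    (fun i => ((y i, -((c : 𝕜) * z φ)) : Y × 𝕜)) hr (fun f hf => by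
      set a : ι → StrongDual 𝕜 Y := fun i => (f i).comp (ContinuousLinearMap.inl 𝕜 Y 𝕜)
      set b : ι → 𝕜 := fun i => f i (0, 1)
      have hfab : ∀ i u s, f i (u, s) = a i u + s * b i := by
        intro i u s
        have : ((u, s) : Y × 𝕜) = (u, 0) + s • (0, 1) := by simp
        rw [this, map_add, map_smul, smul_eq_mul]
        rfl
      have ha : ∑ i, a i = -(((c : 𝕜) * ∑ i, b i) • φ) := by
        ext u
        have := hf u
        simp only [hT, hfab, Finset.sum_add_distrib, ← Finset.mul_sum, map_neg,
          Finset.sum_neg_distrib] at this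
        simp only [_root_.sum_apply, _root_.neg_apply, _root_.smul_apply, smul_eq_mul]
        linear_combination -this
      have hza : ∑ i, z (a i) = -((c : 𝕜) * (∑ i, b i) * z φ) := by
        rw [← map_sum, ha, map_neg, map_smul, smul_eq_mul]
      have hsum : ∑ i, f i (y i, -((c : 𝕜) * z φ)) =
          ∑ i, (z + inclusionInDoubleDual 𝕜 Y (y i)) (a i) := by
        simp only [hfab, Finset.sum_add_distrib, ← Finset.mul_sum, _root_.add_apply, hza, dual_def]
        ring
      rw [hsum, Finset.mul_sum]
      refine norm_sum_le_of_le _ fun i _ => ?_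
      refine ContinuousLinearMap.le_of_opNorm_le_of_le _ (hz i) ?_
      refine ContinuousLinearMap.opNorm_le_bound _ (norm_nonneg _) fun u => ?_
      exact (f i).le_opNorm_of_le (by simp)) hε
  refine ⟨x, fun i => ?_⟩
  have hxi := hx i
  rw [hT, Prod.norm_def, max_lt_iff] at hxi
  simp only [Prod.fst_sub, Prod.snd_sub, sub_neg_eq_add] at hxi
  refine ⟨by rw [add_comm]; exact hxi.1, ?_⟩
  have h2 := hxi.2
  rw [show -((c : 𝕜) * z φ) + c * φ x = (c : 𝕜) * (φ x - z φ) by ring, norm_mul,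
    RCLike.norm_of_nonneg hc.le, hcr] at h2
  exact lt_of_mul_lt_mul_left h2 hc.le

end Bidual

/-! ### M-embedded spaces and their subspaces -/

section Inheritance

open NormedSpace

attribute [local instance] dualNormedAddCommGroup dualNormedSpace

variable {𝕜 : Type*} [RCLike 𝕜]

/-- For an M-ideal `J`, a functional `K` of minimal norm among those that agree with it on `J` is
the component, in the kernel of the L-projection, of every functional agreeing with it on `J`. -/
theorem IsMIdeal.norm_add_norm_sub_le {X : Type*} [NormedAddCommGroup X] [NormedSpace 𝕜 X]
    {J : Submodule 𝕜 X} (hJ : IsMIdeal 𝕜 J) {F K : StrongDual 𝕜 X} (hFK : ∀ x ∈ J, F x = K x)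
    (hK : ∀ G : StrongDual 𝕜 X, (∀ x ∈ J, G x = K x) → ‖K‖ ≤ ‖G‖) :
    ‖K‖ + ‖F - K‖ ≤ ‖F‖ := by
  obtain ⟨P, hP, hPJ⟩ := hJ
  have hidem : ∀ G, P (P G) = P G := fun G => congrArg (fun Q => Q G) hP.proj
  have hnorm : ∀ G, ‖G‖ = ‖P G‖ + ‖G - P G‖ := hP.Lnorm
  have hvanish : ∀ G, ∀ x ∈ J, P G x = 0 := fun G =>
    (StrongDual.mem_polarSubmodule 𝕜 J _).1 (hPJ ▸ ⟨G, rfl⟩)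
  have hfix : ∀ G : StrongDual 𝕜 X, (∀ x ∈ J, G x = 0) → P G = G := fun G hG => by
    obtain ⟨G', rfl⟩ : G ∈ P.range := hPJ ▸ (StrongDual.mem_polarSubmodule 𝕜 J _).2 hG
    exact hidem G'
  have hPK : P K = K - (F - P F) := by
    have h := hfix (K - (F - P F)) fun x hx => by simp [hvanish F x hx, hFK x hx]
    rw [map_sub, map_sub, hidem, sub_self, sub_zero] at h
    exact h
  have hKle := hK (F - P F) fun x hx => by simp [hvanish F x hx, hFK x hx]
  have hKn := hnorm K
  rw [hPK, sub_sub_cancel] at hKn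
  have hzero : K - (F - P F) = 0 := norm_le_zero_iff.1 (by linarith)
  have hKeq : K = F - P F := sub_eq_zero.1 hzero
  rw [hnorm F, hKeq, sub_sub_cancel, add_comm]

variable {E : Type*} [NormedAddCommGroup E] [NormedSpace 𝕜 E]

theorem IsMEmbedded.hasCanonicalLDecomposition (hE : IsMEmbedded 𝕜 E) :
    HasCanonicalLDecomposition 𝕜 E := by
  intro F
  set K := inclusionInDoubleDual 𝕜 (StrongDual 𝕜 E) (F.comp (inclusionInDoubleDual 𝕜 E)) with hKdef
  have hKn : ‖K‖ = ‖F.comp (inclusionInDoubleDual 𝕜 E)‖ :=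
    (inclusionInDoubleDualLi 𝕜 (E := StrongDual 𝕜 E)).norm_map _
  rw [← hKn]
  refine IsMIdeal.norm_add_norm_sub_le hE ?_ ?_
  · rintro _ ⟨e, rfl⟩
    rfl
  · intro G hG
    have hGF : F.comp (inclusionInDoubleDual 𝕜 E) = G.comp (inclusionInDoubleDual 𝕜 E) := by
      ext e
      exact (hG _ ⟨e, rfl⟩).symm
    rw [hKn, hGF]
    refine ContinuousLinearMap.opNorm_le_bound _ (ContinuousLinearMap.opNorm_nonneg _) fun e => ?_
    exact G.le_opNorm_of_le (double_dual_bound 𝕜 E e)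

/-- Hahn–Banach extension along an isometric embedding. -/
theorem exists_dual_comp_linearIsometry_eq {A B : Type*} [NormedAddCommGroup A] [NormedSpace 𝕜 A]
    [NormedAddCommGroup B] [NormedSpace 𝕜 B] (i : A →ₗᵢ[𝕜] B) (g : StrongDual 𝕜 A) :
    ∃ f : StrongDual 𝕜 B, (∀ a, f (i a) = g a) ∧ ‖f‖ ≤ ‖g‖ := by
  let e := i.equivRange
  obtain ⟨f, hf, hfn⟩ := exists_extension_norm_eq _
    (g.comp e.symm.toLinearIsometry.toContinuousLinearMap)
  refine ⟨f, fun a => ?_, ?_⟩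
  · have := hf (e a)
    simpa [e] using this
  · rw [hfn]
    refine ContinuousLinearMap.opNorm_le_bound _ (ContinuousLinearMap.opNorm_nonneg _) fun b => ?_
    exact g.le_opNorm_of_le (e.symm.norm_map b).le

/-- The bidual of a subspace embeds isometrically into the bidual of the space. -/
noncomputable def Submodule.bidualMap (Y : Submodule 𝕜 E) :
    StrongDual 𝕜 (StrongDual 𝕜 Y) →ₗᵢ[𝕜] StrongDual 𝕜 (StrongDual 𝕜 E) where
  toFun y := y.comp (ContinuousLinearMap.precomp 𝕜 Y.subtypeL)
  map_add' _ _ := rfl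
  map_smul' _ _ := rfl
  norm_map' y := by
    apply le_antisymm
    · refine ContinuousLinearMap.opNorm_le_bound _ (ContinuousLinearMap.opNorm_nonneg _) fun φ => ?_
      refine y.le_opNorm_of_le ?_
      exact ContinuousLinearMap.opNorm_le_bound _ (ContinuousLinearMap.opNorm_nonneg _)
        fun u => φ.le_opNorm u
    · refine ContinuousLinearMap.opNorm_le_bound _ (ContinuousLinearMap.opNorm_nonneg _) fun φ => ?_
      obtain ⟨ψ, hψ, hψn⟩ := exists_dual_comp_linearIsometry_eq Y.subtypeₗᵢ φ
      have : φ = ContinuousLinearMap.precomp 𝕜 Y.subtypeL ψ := by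
        ext u
        exact (hψ u).symm
      conv_lhs => rw [this]
      exact (y.comp (ContinuousLinearMap.precomp 𝕜 Y.subtypeL)).le_opNorm_of_le hψn

/-- The canonical decomposition passes to subspaces: a functional on `Y''` is extended to `E''` with
the same norm, and the decomposition of the extension restricts to that of the functional. -/
theorem HasCanonicalLDecomposition.submodule (H : HasCanonicalLDecomposition 𝕜 E)
    (Y : Submodule 𝕜 E) : HasCanonicalLDecomposition 𝕜 Y := by
  intro G
  obtain ⟨F, hF, hFn⟩ := exists_dual_comp_linearIsometry_eq Y.bidualMap G
  refine le_trans ?_ ((H F).trans hFn)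
  gcongr ?_ + ?_
  · refine ContinuousLinearMap.opNorm_le_bound _ (ContinuousLinearMap.opNorm_nonneg _) fun y => ?_
    have : G (inclusionInDoubleDual 𝕜 Y y) = F (inclusionInDoubleDual 𝕜 E y) := (hF _).symm
    change ‖G (inclusionInDoubleDual 𝕜 Y y)‖ ≤ _
    rw [this]
    exact (F.comp (inclusionInDoubleDual 𝕜 E)).le_opNorm y
  · refine ContinuousLinearMap.opNorm_le_bound _ (ContinuousLinearMap.opNorm_nonneg _) fun y => ?_
    set F' := F - inclusionInDoubleDual 𝕜 (StrongDual 𝕜 E) (F.comp (inclusionInDoubleDual 𝕜 E))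
    have hres : (G.comp (inclusionInDoubleDual 𝕜 Y)) =
        ContinuousLinearMap.precomp 𝕜 Y.subtypeL (F.comp (inclusionInDoubleDual 𝕜 E)) := by
      ext u
      exact (hF (inclusionInDoubleDual 𝕜 Y u)).symm
    have : (G - inclusionInDoubleDual 𝕜 (StrongDual 𝕜 Y)
        (G.comp (inclusionInDoubleDual 𝕜 Y))) y = F' (Y.bidualMap y) := by
      change G y - y (G.comp (inclusionInDoubleDual 𝕜 Y)) =
        F (Y.bidualMap y) - (Y.bidualMap y) (F.comp (inclusionInDoubleDual 𝕜 E))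
      rw [hF, hres]
      rfl
    rw [this]
    exact F'.le_opNorm_of_le (Y.bidualMap.norm_map y).le

end Inheritance

/-! ### Finite dimensional subspaces as almost `ℓ^∞`-summands -/

section AlmostSup

open NormedSpace

attribute [local instance] dualNormedAddCommGroup dualNormedSpace

variable {𝕜 : Type*} [RCLike 𝕜] {Y : Type*} [NormedAddCommGroup Y] [NormedSpace 𝕜 Y]

/-- Two-sided estimates for `‖y + a • x‖` follow from upper ones at `a = 1` and from `‖x‖` being
almost one: the upper estimate follows by homogeneity and convexity, the lower one from
`2 y = (y + a x) + (y - a x)` and `2 a x = (y + a x) - (y - a x)`. -/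
theorem norm_add_smul_mem_of_forall_norm_le {F : Submodule 𝕜 Y} {x : Y} {η : ℝ} (hη : 0 ≤ η)
    (hx : 1 - η ≤ ‖x‖) (h : ∀ y ∈ F, ‖y‖ ≤ 1 → ‖x + y‖ ≤ 1 + η) {y : Y} (hy : y ∈ F) (a : 𝕜) :
    (1 - 3 * η) * max ‖y‖ ‖a‖ ≤ ‖y + a • x‖ ∧ ‖y + a • x‖ ≤ (1 + η) * max ‖y‖ ‖a‖ := by
  have hunim : ∀ y ∈ F, ∀ u : 𝕜, ‖u‖ = 1 → ∀ M : ℝ, 0 < M → ‖y‖ ≤ M →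
      ‖y + ((M : 𝕜) * u) • x‖ ≤ (1 + η) * M := by
    intro y hy u hu M hM hyM
    have hMu : (M : 𝕜) * u ≠ 0 :=
      mul_ne_zero (by exact_mod_cast hM.ne') (norm_ne_zero_iff.1 (by rw [hu]; exact one_ne_zero))
    have hn : ‖(M : 𝕜) * u‖ = M := by rw [norm_mul, hu, RCLike.norm_of_nonneg hM.le, mul_one]
    have := h (((M : 𝕜) * u)⁻¹ • y) (F.smul_mem _ hy) (by
      rw [norm_smul, norm_inv, hn, inv_mul_le_one₀ hM]; exact hyM)
    calc ‖y + ((M : 𝕜) * u) • x‖ = ‖((M : 𝕜) * u) • (x + ((M : 𝕜) * u)⁻¹ • y)‖ := by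
          rw [smul_add, smul_inv_smul₀ hMu, add_comm]
      _ = M * ‖x + ((M : 𝕜) * u)⁻¹ • y‖ := by rw [norm_smul, hn]
      _ ≤ M * (1 + η) := by gcongr
      _ = (1 + η) * M := mul_comm _ _
  have hupper : ∀ y ∈ F, ∀ a : 𝕜, ‖y + a • x‖ ≤ (1 + η) * max ‖y‖ ‖a‖ := by
    intro y hy a
    set M := max ‖y‖ ‖a‖ with hMdef
    rcases (le_max_of_le_left (norm_nonneg y) : 0 ≤ M).eq_or_lt with hM | hM
    · have hy0 : y = 0 := norm_le_zero_iff.1 (hM ▸ le_max_left _ _)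
      have ha0 : a = 0 := norm_le_zero_iff.1 (hM ▸ le_max_right _ _)
      rw [hMdef, ← hM, hy0, ha0]
      simp
    · obtain ⟨u, hu, hau⟩ : ∃ u : 𝕜, ‖u‖ = 1 ∧ a = ‖a‖ * u := by
        obtain ⟨u, hu, hau⟩ := RCLike.exists_norm_mul_eq_self a
        exact ⟨u, hu, by rw [mul_comm] at hau; rw [mul_comm]; simpa [mul_comm] using hau.symm⟩
      -- `a` lies on the segment between `M u` and `-M u`.
      set t : ℝ := ‖a‖ / M
      have ht0 : 0 ≤ t := by positivity
      have ht1 : t ≤ 1 := (div_le_one hM).2 (le_max_right _ _)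
      have hat : a = (t : 𝕜) * ((M : 𝕜) * u) := by
        rw [← mul_assoc, ← RCLike.ofReal_mul, div_mul_cancel₀ _ hM.ne', ← hau]
      have hcomb : y + a • x = (((1 + t) / 2 : ℝ) : 𝕜) • (y + ((M : 𝕜) * u) • x) +
          (((1 - t) / 2 : ℝ) : 𝕜) • (y + ((M : 𝕜) * -u) • x) := by
        rw [hat]
        push_cast
        module
      have hyM : ‖y‖ ≤ M := le_max_left _ _
      have h1 := hunim y hy u hu M hM hyM
      have h2 := hunim y hy (-u) (by rwa [norm_neg]) M hM hyM
      rw [hcomb]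
      calc _ ≤ (1 + t) / 2 * ‖y + ((M : 𝕜) * u) • x‖ +
            (1 - t) / 2 * ‖y + ((M : 𝕜) * -u) • x‖ := by
            refine (norm_add_le _ _).trans ?_
            rw [norm_smul, norm_smul, RCLike.norm_of_nonneg (by linarith),
              RCLike.norm_of_nonneg (by linarith)]
        _ ≤ (1 + t) / 2 * ((1 + η) * M) + (1 - t) / 2 * ((1 + η) * M) := by
            gcongr
        _ = (1 + η) * M := by ring
  refine ⟨?_, hupper y hy a⟩
  have hsub : ‖y - a • x‖ ≤ (1 + η) * max ‖y‖ ‖a‖ := by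
    simpa [sub_eq_add_neg] using hupper y hy (-a)
  have h1 : 2 * ‖y‖ ≤ ‖y + a • x‖ + ‖y - a • x‖ := by
    have := norm_add_le (y + a • x) (y - a • x)
    rwa [show y + a • x + (y - a • x) = (2 : 𝕜) • y by module, norm_smul, RCLike.norm_ofNat] at this
  have h2 : 2 * (‖a‖ * ‖x‖) ≤ ‖y + a • x‖ + ‖y - a • x‖ := by
    have := norm_sub_le (y + a • x) (y - a • x)
    rwa [show y + a • x - (y - a • x) = (2 : 𝕜) • (a • x) by module, norm_smul, norm_smul,
      RCLike.norm_ofNat] at this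
  have h3 : ‖a‖ * (1 - η) ≤ ‖a‖ * ‖x‖ := by gcongr
  have h4 : (1 - η) * max ‖y‖ ‖a‖ ≤ max ‖y‖ (‖a‖ * ‖x‖) := by
    rcases max_cases ‖y‖ ‖a‖ with ⟨h, _⟩ | ⟨h, _⟩ <;> rw [h]
    · exact le_max_of_le_left (by nlinarith [norm_nonneg y])
    · exact le_max_of_le_right (by linarith)
  have h5 : 2 * max ‖y‖ (‖a‖ * ‖x‖) ≤ ‖y + a • x‖ + ‖y - a • x‖ := by
    rcases max_cases ‖y‖ (‖a‖ * ‖x‖) with ⟨h, _⟩ | ⟨h, _⟩ <;> rw [h] <;> assumption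
  linarith

/-- In a nonreflexive Banach space whose third dual decomposes as an `ℓ¹`-sum, every finite
dimensional subspace is almost an `ℓ^∞`-summand of a subspace with one dimension more. -/
theorem HasCanonicalLDecomposition.exists_norm_add_smul_mem [CompleteSpace Y]
    (H : HasCanonicalLDecomposition 𝕜 Y) (hY : ¬ IsReflexiveSpace 𝕜 Y) (F : Submodule 𝕜 Y)
    [FiniteDimensional 𝕜 F] {ε : ℝ} (hε : 0 < ε) :
    ∃ x : Y, ∀ y ∈ F, ∀ a : 𝕜, (1 - ε) * max ‖y‖ ‖a‖ ≤ ‖y + a • x‖ ∧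
      ‖y + a • x‖ ≤ (1 + ε) * max ‖y‖ ‖a‖ := by
  obtain ⟨θ, hθ, hθε⟩ : ∃ θ > 0, ε = 9 * θ := ⟨ε / 9, by positivity, by ring⟩
  -- A point of the unit sphere of the bidual at distance almost one from `Y`.
  obtain ⟨x₀, -, hx₀, hdist⟩ := riesz_lemma_of_lt_one (𝕜 := 𝕜)
    (F := LinearMap.range (inclusionInDoubleDual 𝕜 Y).toLinearMap)
    (inclusionInDoubleDualLi 𝕜 (E := Y)).isometry.isClosedEmbedding.isClosed_range
    (by
      simp only [IsReflexiveSpace, Function.Surjective, not_forall, not_exists] at hY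
      obtain ⟨x, hx⟩ := hY
      exact ⟨x, fun ⟨y, hy⟩ => hx y hy⟩) (show 1 - θ < 1 by linarith)
  -- A finite net of the unit ball of `F`.
  have := FiniteDimensional.proper_rclike 𝕜 F
  obtain ⟨t, ht, htfin, hcover⟩ :=
    (isCompact_closedBall (0 : F) 1).finite_cover_balls hθ
  have := htfin.fintype
  have htn : ∀ i : t, ‖((i : F) : Y)‖ ≤ 1 := fun i => by simpa using ht i.2
  obtain ⟨z, hz⟩ := H.exists_forall_norm_add_sub_lt (fun i : t => ((i : F) : Y)) htn x₀ hx₀.le hθ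
  set z₀ := x₀ - inclusionInDoubleDual 𝕜 Y z
  have hz₀ : 1 - θ ≤ ‖z₀‖ := hdist _ ⟨z, rfl⟩
  obtain ⟨φ, hφ, hzφ⟩ := z₀.exists_lt_apply_of_lt_opNorm (r := 1 - 2 * θ) (by linarith)
  obtain ⟨x, hx⟩ := exists_forall_norm_add_lt_and_norm_apply_sub_lt
    (fun i : t => ((i : F) : Y)) z₀ φ (r := 1 + θ) (by linarith)
    (fun i => by rw [sub_add_eq_add_sub]; exact (hz i).le) hθ
  have hnet : ∀ y ∈ F, ‖y‖ ≤ 1 → ∃ i : t, ‖y - ((i : F) : Y)‖ < θ := by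
    intro y hy hy1
    have := hcover (show (⟨y, hy⟩ : F) ∈ Metric.closedBall (0 : F) 1 by simpa using hy1)
    simp only [Set.mem_iUnion] at this
    obtain ⟨i, hi, hyi⟩ := this
    exact ⟨⟨i, hi⟩, by simpa [dist_eq_norm] using hyi⟩
  have hxn : 1 - 3 * θ ≤ ‖x‖ := by
    obtain ⟨i, -⟩ := hnet 0 F.zero_mem (by simp)
    have h1 := (hx i).2
    have h2 : ‖φ x‖ ≤ ‖x‖ := (φ.le_of_opNorm_le hφ.le x).trans (by rw [one_mul])
    have h3 := norm_sub_norm_le (z₀ φ) (φ x)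
    rw [norm_sub_rev] at h3
    linarith
  refine ⟨x, fun y hy a => ?_⟩
  have := norm_add_smul_mem_of_forall_norm_le (η := 3 * θ) (by linarith) hxn (fun y hy hy1 => by
    obtain ⟨i, hi⟩ := hnet y hy hy1
    have h1 := (hx i).1
    have h2 := norm_add_le (x + ((i : F) : Y)) (y - ((i : F) : Y))
    rw [add_add_sub_cancel] at h2
    linarith) hy a
  rw [hθε]
  refine ⟨by linarith [this.1], this.2.trans ?_⟩
  gcongr
  linarith

/-- A sequence each of whose terms is, up to `ε n`, an `ℓ^∞`-complement of the span of the previous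
ones. -/
theorem HasCanonicalLDecomposition.exists_seq_norm_sum_add_smul_mem [CompleteSpace Y]
    (H : HasCanonicalLDecomposition 𝕜 Y) (hY : ¬ IsReflexiveSpace 𝕜 Y) (ε : ℕ → ℝ)
    (hε : ∀ n, 0 < ε n) :
    ∃ x : ℕ → Y, ∀ (n : ℕ) (α : ℕ → 𝕜),
      (1 - ε n) * max ‖∑ k ∈ Finset.range n, α k • x k‖ ‖α n‖
        ≤ ‖∑ k ∈ Finset.range (n + 1), α k • x k‖ ∧
      ‖∑ k ∈ Finset.range (n + 1), α k • x k‖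
        ≤ (1 + ε n) * max ‖∑ k ∈ Finset.range n, α k • x k‖ ‖α n‖ := by
  have step : ∀ (n : ℕ) (F : {F : Submodule 𝕜 Y // FiniteDimensional 𝕜 F}), ∃ x : Y,
      ∀ y ∈ F.1, ∀ a : 𝕜, (1 - ε n) * max ‖y‖ ‖a‖ ≤ ‖y + a • x‖ ∧
        ‖y + a • x‖ ≤ (1 + ε n) * max ‖y‖ ‖a‖ := fun n F => by
    have := F.2
    exact H.exists_norm_add_smul_mem hY F.1 (hε n)
  choose g hg using step
  let V : ℕ → {F : Submodule 𝕜 Y // FiniteDimensional 𝕜 F} := fun n =>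
    Nat.rec ⟨⊥, inferInstance⟩
      (fun n F => ⟨F.1 ⊔ Submodule.span 𝕜 {g n F}, have := F.2; inferInstance⟩) n
  have hsucc : ∀ n, (V (n + 1)).1 = (V n).1 ⊔ Submodule.span 𝕜 {g n (V n)} := fun _ => rfl
  have hmono : Monotone fun n => (V n).1 := monotone_nat_of_le_succ fun n => by
    rw [hsucc]; exact le_sup_left
  have hmem : ∀ k, g k (V k) ∈ (V (k + 1)).1 := fun k => by
    rw [hsucc]
    exact Submodule.mem_sup_right (Submodule.mem_span_singleton_self _)
  refine ⟨fun n => g n (V n), fun n α => ?_⟩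
  rw [Finset.sum_range_succ]
  exact hg n (V n) _ (Submodule.sum_mem _ fun k hk => Submodule.smul_mem _ _
    (hmono (Finset.mem_range.1 hk) (hmem k))) (α n)

end AlmostSup

/-! ### Sequences with `c₀`-estimates -/

section C0Sequences

variable {𝕜 : Type*} [RCLike 𝕜] {Z : Type*} [NormedAddCommGroup Z] [NormedSpace 𝕜 Z]

variable (𝕜) in
/-- The norm of `∑ k < m, α k • x k` lies between `max (1 - δ k) ‖α k‖` and `max (1 + δ k) ‖α k‖`;
the maxima are expressed through their lower and upper bounds. -/
def HasC0Estimates (δ : ℕ → ℝ) (x : ℕ → Z) : Prop :=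
  ∀ (m : ℕ) (α : ℕ → 𝕜),
    (∀ k < m, (1 - δ k) * ‖α k‖ ≤ ‖∑ k ∈ Finset.range m, α k • x k‖) ∧
    ∀ M : ℝ, 0 ≤ M → (∀ k < m, (1 + δ k) * ‖α k‖ ≤ M) →
      ‖∑ k ∈ Finset.range m, α k • x k‖ ≤ M

theorem hasC0Estimates_coe_iff {Y : Submodule 𝕜 Z} {δ : ℕ → ℝ} {x : ℕ → Y} :
    HasC0Estimates 𝕜 δ (fun n => (x n : Z)) ↔ HasC0Estimates 𝕜 δ x := by
  refine forall₂_congr fun m α => ?_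
  have h : ∑ k ∈ Finset.range m, α k • (x k : Z) = (∑ k ∈ Finset.range m, α k • x k : Y) := by
    simp
  rw [h]
  rfl

/-- One-step estimates with small enough errors accumulate to prescribed `c₀`-estimates: the
quotients of consecutive factors `1 + δ m` (and `1 - δ m`) leave room for the error of step `m`. -/
theorem HasCanonicalLDecomposition.exists_hasC0Estimates [CompleteSpace Z]
    (H : HasCanonicalLDecomposition 𝕜 Z) (hZ : ¬ IsReflexiveSpace 𝕜 Z) {δ : ℕ → ℝ}
    (hδ : StrictAnti δ) (hδ0 : ∀ n, 0 ≤ δ n) (hδ1 : ∀ n, δ n < 1) :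
    ∃ x : ℕ → Z, HasC0Estimates 𝕜 δ x := by
  set ε : ℕ → ℝ := fun m => (δ m - δ (m + 1)) / (1 + δ (m + 1)) with hεdef
  have hlt : ∀ m, δ (m + 1) < δ m := fun m => hδ (Nat.lt_succ_self m)
  have hε : ∀ m, 0 < ε m := fun m =>
    div_pos (sub_pos.2 (hlt m)) (by linarith [hδ0 (m + 1)])
  have hεmul : ∀ m, ε m * (1 + δ (m + 1)) = δ m - δ (m + 1) := fun m =>
    div_mul_cancel₀ _ (by linarith [hδ0 (m + 1)])
  obtain ⟨x, hx⟩ := H.exists_seq_norm_sum_add_smul_mem hZ ε hε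
  refine ⟨x, fun m α => ⟨?_, ?_⟩⟩
  · suffices h : ∀ k < m, (1 - δ k) * ‖α k‖ ≤
        (1 - δ m) * ‖∑ k ∈ Finset.range m, α k • x k‖ from fun k hk =>
      (h k hk).trans (mul_le_of_le_one_left (norm_nonneg _) (by linarith [hδ0 m]))
    induction m with
    | zero => intro k hk; exact absurd hk (Nat.not_lt_zero k)
    | succ m ih =>
      set M := max ‖∑ k ∈ Finset.range m, α k • x k‖ ‖α m‖
      have hM0 : 0 ≤ M := le_max_of_le_right (norm_nonneg _)
      have h1 : (1 - δ m) * M ≤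
          (1 - δ (m + 1)) * ‖∑ k ∈ Finset.range (m + 1), α k • x k‖ := by
        have hfac : 1 - δ m ≤ (1 - δ (m + 1)) * (1 - ε m) := by
          nlinarith [hεmul m, hδ0 (m + 1), hε m]
        calc (1 - δ m) * M ≤ (1 - δ (m + 1)) * (1 - ε m) * M := by gcongr
          _ = (1 - δ (m + 1)) * ((1 - ε m) * M) := mul_assoc _ _ _
          _ ≤ _ := mul_le_mul_of_nonneg_left (hx m α).1 (by linarith [hδ1 (m + 1)])
      have hpos : 0 ≤ 1 - δ m := by linarith [hδ1 m]
      intro k hk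
      refine le_trans ?_ h1
      rcases Nat.lt_succ_iff_lt_or_eq.1 hk with hk | rfl
      · exact (ih k hk).trans (mul_le_mul_of_nonneg_left (le_max_left _ _) hpos)
      · exact mul_le_mul_of_nonneg_left (le_max_right _ _) hpos
  · suffices h : ∀ C : ℝ, 0 ≤ C → (∀ k < m, (1 + δ k) * ‖α k‖ ≤ (1 + δ m) * C) →
        ‖∑ k ∈ Finset.range m, α k • x k‖ ≤ C from fun M hM hk =>
      h M hM fun k hkm => (hk k hkm).trans (le_mul_of_one_le_left hM (by linarith [hδ0 m]))
    induction m with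
    | zero => intro C hC _; simpa using hC
    | succ m ih =>
      intro C hC hk
      have hpos : 0 < 1 + δ m := by linarith [hδ0 m]
      set C' := (1 + δ (m + 1)) * C / (1 + δ m)
      have hC' : 0 ≤ C' := div_nonneg (mul_nonneg (by linarith [hδ0 (m + 1)]) hC) hpos.le
      have hC'mul : (1 + δ m) * C' = (1 + δ (m + 1)) * C := mul_div_cancel₀ _ hpos.ne'
      have h1 := ih C' hC' fun k hkm => hC'mul ▸ hk k (hkm.trans (Nat.lt_succ_self m))
      have h2 : ‖α m‖ ≤ C' :=
        le_of_mul_le_mul_left (hC'mul ▸ hk m (Nat.lt_succ_self m)) hpos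
      refine (hx m α).2.trans ?_
      calc (1 + ε m) * max ‖∑ k ∈ Finset.range m, α k • x k‖ ‖α m‖ ≤ (1 + ε m) * C' := by
            have := hε m
            gcongr
            exact max_le h1 h2
        _ ≤ C := by
            have : (1 + ε m) * (1 + δ (m + 1)) = 1 + δ m := by linarith [hεmul m]
            rw [← mul_div_assoc, div_le_iff₀ hpos, ← mul_assoc, this, mul_comm]

namespace HasC0Estimates

variable {δ : ℕ → ℝ} {x : ℕ → Z}

theorem spansC0Asymptotically (hx : HasC0Estimates 𝕜 δ x) (hδ : ∀ n, 0 ≤ δ n ∧ δ n < 1)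
    (hδ0 : Tendsto δ atTop (𝓝 0)) : SpansC0Asymptotically 𝕜 x := by
  refine ⟨δ, hδ, hδ0, fun m α => ⟨?_, ?_⟩⟩
  · exact Finset.sup'_le _ _ fun k hk => (hx (m + 1) α).1 k (Finset.mem_range.1 hk)
  · have hle : ∀ k < m + 1, (1 + δ k) * ‖α k‖ ≤ (Finset.range (m + 1)).sup'
        Finset.nonempty_range_add_one (fun n => (1 + δ n) * ‖α n‖) := fun k hk =>
      Finset.le_sup' (fun n => (1 + δ n) * ‖α n‖) (Finset.mem_range.2 hk)
    refine (hx (m + 1) α).2 _ (le_trans ?_ (hle 0 m.succ_pos)) hle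
    have := (hδ 0).1
    positivity

theorem exists_sum_eq_linearCombination (x : ℕ → Z) (l : ℕ →₀ 𝕜) (i : ℕ) :
    ∃ m, i < m ∧ Finsupp.linearCombination 𝕜 x l = ∑ k ∈ Finset.range m, l k • x k := by
  refine ⟨l.support.sup id + i + 1, by omega, ?_⟩
  rw [Finsupp.linearCombination_apply]
  refine Finsupp.sum_of_support_subset _ (fun k hk => ?_) _ fun k _ => zero_smul _ _
  have : k ≤ l.support.sup id := Finset.le_sup (f := id) hk
  exact Finset.mem_range.2 (by omega)

theorem linearIndependent (hx : HasC0Estimates 𝕜 δ x) (hδ : ∀ n, δ n < 1) :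
    LinearIndependent 𝕜 x := by
  refine linearIndependent_iff.2 fun l hl => Finsupp.ext fun i => ?_
  obtain ⟨m, him, hm⟩ := exists_sum_eq_linearCombination x l i
  have h := (hx m l).1 i him
  rw [← hm, hl, norm_zero] at h
  have : 0 < 1 - δ i := by linarith [hδ i]
  exact norm_le_zero_iff.1 (nonpos_of_mul_nonpos_right h this)

theorem exists_biorthogonal (hx : HasC0Estimates 𝕜 δ x) (hδ : ∀ n, δ n < 1) :
    ∃ f : ℕ → StrongDual 𝕜 Z, ∀ i j, f i (x j) = (Pi.single j (1 : 𝕜) : ℕ → 𝕜) i := by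
  have hli := hx.linearIndependent hδ
  have : ∀ i, ∃ f : StrongDual 𝕜 Z, ∀ j, f (x j) = (Pi.single j (1 : 𝕜) : ℕ → 𝕜) i := by
    intro i
    have hpos : 0 < 1 - δ i := by linarith [hδ i]
    let g : StrongDual 𝕜 (Submodule.span 𝕜 (Set.range x)) :=
      LinearMap.mkContinuous (Finsupp.lapply i ∘ₗ hli.repr) (1 - δ i)⁻¹ fun w => by
        obtain ⟨m, him, hm⟩ := exists_sum_eq_linearCombination x (hli.repr w) i
        have h := (hx m (hli.repr w)).1 i him
        rw [← hm, hli.linearCombination_repr] at h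
        rw [le_inv_mul_iff₀ hpos]
        exact h
    obtain ⟨f, hf, -⟩ := exists_extension_norm_eq _ g
    refine ⟨f, fun j => ?_⟩
    have h := hf ⟨x j, Submodule.subset_span ⟨j, rfl⟩⟩
    refine h.trans ?_
    change hli.repr ⟨x j, Submodule.subset_span ⟨j, rfl⟩⟩ i = _
    rw [hli.repr_eq_single j _ rfl, Finsupp.single_eq_pi_single]
  choose f hf using this
  exact ⟨f, hf⟩

section Biorthogonal

variable {f : ℕ → StrongDual 𝕜 Z}

theorem apply_sum_range (hf : ∀ i j, f i (x j) = (Pi.single j (1 : 𝕜) : ℕ → 𝕜) i) (i m : ℕ)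
    (α : ℕ → 𝕜) : f i (∑ k ∈ Finset.range m, α k • x k) = if i < m then α i else 0 := by
  simp [map_sum, hf, Pi.single_apply]

theorem norm_apply_le (hx : HasC0Estimates 𝕜 δ x)
    (hf : ∀ i j, f i (x j) = (Pi.single j (1 : 𝕜) : ℕ → 𝕜) i) {w : Z}
    (hw : w ∈ (Submodule.span 𝕜 (Set.range x)).topologicalClosure) (i : ℕ) :
    (1 - δ i) * ‖f i w‖ ≤ ‖w‖ := by
  have hclosed : IsClosed {w : Z | (1 - δ i) * ‖f i w‖ ≤ ‖w‖} :=
    isClosed_le (by fun_prop) continuous_norm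
  refine closure_minimal (fun v hv => ?_) hclosed hw
  obtain ⟨l, rfl⟩ := (Finsupp.mem_span_range_iff_exists_finsupp).1 hv
  obtain ⟨m, him, hm⟩ := exists_sum_eq_linearCombination x l i
  rw [Finsupp.linearCombination_apply] at hm
  rw [Set.mem_ofPred_eq, hm, apply_sum_range hf, if_pos him]
  exact (hx m l).1 i him

theorem norm_sum_apply_le (hx : HasC0Estimates 𝕜 δ x) (hδ : ∀ n, δ n ≤ 1 / 2)
    (hf : ∀ i j, f i (x j) = (Pi.single j (1 : 𝕜) : ℕ → 𝕜) i) {w : Z}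
    (hw : w ∈ (Submodule.span 𝕜 (Set.range x)).topologicalClosure) (m : ℕ) :
    ‖∑ k ∈ Finset.range m, f k w • x k‖ ≤ 3 * ‖w‖ := by
  refine (hx m fun k => f k w).2 _ (by positivity) fun k _ => ?_
  nlinarith [hx.norm_apply_le hf hw k, hδ k, norm_nonneg (f k w)]

/-- On the closed span the expansions converge: they do so trivially on the span, and the partial
sum operators are uniformly bounded. -/
theorem tendsto_sum_apply (hx : HasC0Estimates 𝕜 δ x) (hδ : ∀ n, δ n ≤ 1 / 2)
    (hf : ∀ i j, f i (x j) = (Pi.single j (1 : 𝕜) : ℕ → 𝕜) i) {w : Z}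
    (hw : w ∈ (Submodule.span 𝕜 (Set.range x)).topologicalClosure) :
    Tendsto (fun m => ∑ k ∈ Finset.range m, f k w • x k) atTop (𝓝 w) := by
  rw [Metric.tendsto_atTop]
  intro η hη
  obtain ⟨v, hv, hwv⟩ := Metric.mem_closure_iff.1 hw (η / 4) (by positivity)
  obtain ⟨l, hl⟩ := (Finsupp.mem_span_range_iff_exists_finsupp).1 hv
  obtain ⟨N, -, hN⟩ := exists_sum_eq_linearCombination x l 0
  rw [Finsupp.linearCombination_apply, hl] at hN
  refine ⟨N, fun m hm => ?_⟩
  have hvm : ∑ k ∈ Finset.range m, f k v • x k = v := by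
    conv_rhs => rw [hN]
    rw [← Finset.sum_subset (Finset.range_subset_range.2 hm)]
    · refine Finset.sum_congr rfl fun k hk => ?_
      rw [hN, apply_sum_range hf, if_pos (Finset.mem_range.1 hk)]
    · intro k _ hk
      rw [hN, apply_sum_range hf, if_neg (by simpa using hk), zero_smul]
  have hsub := hx.norm_sum_apply_le hδ hf
    (Submodule.sub_mem _ hw (Submodule.le_topologicalClosure _ hv)) m
  have heq : ∑ k ∈ Finset.range m, f k w • x k - w =
      ∑ k ∈ Finset.range m, f k (w - v) • x k - (w - v) := by
    simp only [map_sub, sub_smul, Finset.sum_sub_distrib, hvm]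
    abel
  rw [dist_eq_norm] at hwv ⊢
  rw [heq]
  linarith [norm_sub_le (∑ k ∈ Finset.range m, f k (w - v) • x k) (w - v)]

theorem norm_le_of_forall_norm_apply_le (hx : HasC0Estimates 𝕜 δ x) (hδ : ∀ n, δ n ≤ 1 / 2)
    (hf : ∀ i j, f i (x j) = (Pi.single j (1 : 𝕜) : ℕ → 𝕜) i) {w : Z}
    (hw : w ∈ (Submodule.span 𝕜 (Set.range x)).topologicalClosure) {M : ℝ} (hM : 0 ≤ M)
    (h : ∀ k, (1 + δ k) * ‖f k w‖ ≤ M) : ‖w‖ ≤ M :=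
  le_of_tendsto (hx.tendsto_sum_apply hδ hf hw).norm <|
    Eventually.of_forall fun m => (hx m fun k => f k w).2 M hM fun k _ => h k

theorem tendsto_apply (hx : HasC0Estimates 𝕜 δ x) (hδ : ∀ n, δ n ≤ 1 / 2)
    (hf : ∀ i j, f i (x j) = (Pi.single j (1 : 𝕜) : ℕ → 𝕜) i) {w : Z}
    (hw : w ∈ (Submodule.span 𝕜 (Set.range x)).topologicalClosure) :
    Tendsto (fun k => f k w) atTop (𝓝 0) := by
  have hS := hx.tendsto_sum_apply hδ hf hw
  have hdiff := ((hS.comp (tendsto_add_atTop_nat 1)).sub hS).norm.const_mul 2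
  rw [sub_self, norm_zero, mul_zero] at hdiff
  refine squeeze_zero_norm (fun k => ?_) hdiff
  have hxk : x k ∈ (Submodule.span 𝕜 (Set.range x)).topologicalClosure :=
    Submodule.le_topologicalClosure _ (Submodule.subset_span ⟨k, rfl⟩)
  have h := hx.norm_apply_le hf (Submodule.smul_mem _ (f k w) hxk) k
  rw [map_smul, hf, Pi.single_eq_same, smul_eq_mul, mul_one] at h
  rw [Function.comp_apply, Finset.sum_range_succ, add_sub_cancel_left]
  nlinarith [hδ k, norm_nonneg (f k w)]

theorem exists_forall_apply_eq [CompleteSpace Z] (hx : HasC0Estimates 𝕜 δ x)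
    (hδ : ∀ n, δ n ≤ 1 / 2) (hf : ∀ i j, f i (x j) = (Pi.single j (1 : 𝕜) : ℕ → 𝕜) i)
    {α : ℕ → 𝕜} (hα : Tendsto α atTop (𝓝 0)) :
    ∃ w ∈ (Submodule.span 𝕜 (Set.range x)).topologicalClosure, ∀ k, f k w = α k := by
  have hcauchy : CauchySeq fun m => ∑ k ∈ Finset.range m, α k • x k := by
    refine Metric.cauchySeq_iff'.2 fun η hη => ?_
    obtain ⟨N, hN⟩ := Metric.tendsto_atTop.1 hα (η / 4) (by positivity)
    refine ⟨N, fun n hn => ?_⟩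
    have heq : ∑ k ∈ Finset.range n, α k • x k - ∑ k ∈ Finset.range N, α k • x k =
        ∑ k ∈ Finset.range n, (if k < N then 0 else α k) • x k := by
      rw [sub_eq_iff_eq_add, ← Finset.sum_range_add_sum_Ico _ hn,
        ← Finset.sum_range_add_sum_Ico _ hn, add_comm, add_right_comm]
      have h1 : ∑ k ∈ Finset.range N, (if k < N then 0 else α k) • x k = 0 :=
        Finset.sum_eq_zero fun k hk => by rw [if_pos (Finset.mem_range.1 hk), zero_smul]
      have h2 : ∑ k ∈ Finset.Ico N n, (if k < N then 0 else α k) • x k =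
          ∑ k ∈ Finset.Ico N n, α k • x k :=
        Finset.sum_congr rfl fun k hk => by rw [if_neg (Finset.mem_Ico.1 hk).1.not_gt]
      rw [h1, h2]
      abel
    rw [dist_eq_norm, heq]
    refine lt_of_le_of_lt ((hx n _).2 (η / 2) (by positivity) fun k _ => ?_) (half_lt_self hη)
    split_ifs with hk
    · rw [norm_zero, mul_zero]; positivity
    · have := hN k (not_lt.1 hk)
      rw [dist_zero_right] at this
      nlinarith [hδ k, norm_nonneg (α k)]
  obtain ⟨w, hw⟩ := cauchySeq_tendsto_of_complete hcauchy
  refine ⟨w, mem_closure_of_tendsto hw <| Eventually.of_forall fun m =>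
    Submodule.sum_mem _ fun k _ => Submodule.smul_mem _ _ (Submodule.subset_span ⟨k, rfl⟩),
    fun k => ?_⟩
  refine tendsto_nhds_unique (((f k).continuous.tendsto w).comp hw)
    (tendsto_const_nhds.congr' ?_)
  filter_upwards [eventually_gt_atTop k] with m hm
  rw [Function.comp_apply, apply_sum_range hf, if_pos hm]

end Biorthogonal

theorem isAsymptoticallyIsometricToC0 (hx : HasC0Estimates 𝕜 δ x)
    (hδ : ∀ n, 0 ≤ δ n ∧ δ n ≤ 1 / 2) (hδ0 : Tendsto δ atTop (𝓝 0)) :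
    IsAsymptoticallyIsometricToC0 𝕜 (Submodule.span 𝕜 (Set.range x)).topologicalClosure := by
  have hδ1 : ∀ n, δ n < 1 := fun n => (hδ n).2.trans_lt one_half_lt_one
  obtain ⟨f, hf⟩ := hx.exists_biorthogonal hδ1
  set W := (Submodule.span 𝕜 (Set.range x)).topologicalClosure
  let b : SchauderBasis 𝕜 W :=
    { basis := fun n => ⟨x n, Submodule.le_topologicalClosure _ (Submodule.subset_span ⟨n, rfl⟩)⟩
      coord := fun n => (f n).comp W.subtypeL
      ortho := fun i j => (hf i j).trans (by simp [Pi.single_apply])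
      expansion := fun w => by
        rw [HasSum, SummationFilter.conditional_filter_eq_map_range, tendsto_map'_iff,
          tendsto_subtype_rng]
        refine (hx.tendsto_sum_apply (fun n => (hδ n).2) hf w.2).congr fun m => ?_
        simp }
  have hb : HasC0Estimates 𝕜 δ (fun n => b n) := hasC0Estimates_coe_iff.1 hx
  exact ⟨b, hb.spansC0Asymptotically (fun n => ⟨(hδ n).1, hδ1 n⟩) hδ0⟩

end HasC0Estimates

end C0Sequences

/-! ### Contractive maps without fixed points -/

section FixedPoints

theorem exists_lt_forall_le_of_tendsto_zero {a : ℕ → ℝ} (ha : Tendsto a atTop (𝓝 0)) {d : ℝ}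
    (hd : 0 < d) (h : ∀ n, a n < d) : ∃ M, 0 ≤ M ∧ M < d ∧ ∀ n, a n ≤ M := by
  obtain ⟨N, hN⟩ := eventually_atTop.1 (ha.eventually (gt_mem_nhds (half_pos hd)))
  obtain ⟨k, -, hk⟩ := Finset.exists_max_image (Finset.range (N + 1)) a
    Finset.nonempty_range_add_one
  refine ⟨max (d / 2) (a k), le_max_of_le_left (by positivity),
    max_lt (half_lt_self hd) (h k), fun n => ?_⟩
  rcases lt_or_ge n N with hn | hn
  · exact le_max_of_le_right (hk n (Finset.mem_range.2 (by omega)))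
  · exact le_max_of_le_left (hN n hn).le

variable {𝕜 : Type*} [RCLike 𝕜] {Z : Type*} [NormedAddCommGroup Z] [NormedSpace 𝕜 Z]
  [NormedSpace ℝ Z] [IsScalarTower ℝ 𝕜 Z] [CompleteSpace Z]

/-- On the elements of the closed span with `n`-th coordinate in `[0, γ n]`, the map acting on
coordinates by `t 0, t 1, … ↦ γ 0, (γ 1 / γ 0) t 0, (γ 2 / γ 1) t 1, …` is contractive because `γ`
decreases fast in comparison with `δ`. The coordinates of a fixed point would be `γ n ≥ 1`, which
do not tend to `0`. -/
theorem HasC0Estimates.not_hasFixedPointProperty {δ γ : ℕ → ℝ} {x : ℕ → Z}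
    (hx : HasC0Estimates 𝕜 δ x) (hδ : ∀ n, 0 ≤ δ n ∧ δ n ≤ 1 / 2) (hγ : ∀ n, 1 ≤ γ n ∧ γ n ≤ 2)
    (hδγ : ∀ n, (1 + δ (n + 1)) * γ (n + 1) < (1 - δ n) * γ n) : ¬ HasFixedPointProperty Z := by
  have hδ2 : ∀ n, δ n ≤ 1 / 2 := fun n => (hδ n).2
  obtain ⟨f, hf⟩ := hx.exists_biorthogonal fun n => (hδ2 n).trans_lt one_half_lt_one
  set W := (Submodule.span 𝕜 (Set.range x)).topologicalClosure
  have hγpos : ∀ n, 0 < γ n := fun n => zero_lt_one.trans_le (hγ n).1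
  set C : Set Z := {w | w ∈ W ∧ ∀ n, ∃ t : ℝ, 0 ≤ t ∧ t ≤ γ n ∧ f n w = t} with hCdef
  have hne : C.Nonempty := ⟨0, W.zero_mem, fun n => ⟨0, le_rfl, (hγpos n).le, by simp⟩⟩
  have hclosed : IsClosed C := by
    have hCeq : C = (W : Set Z) ∩
        ⋂ n, f n ⁻¹' ((fun t : ℝ => (t : 𝕜)) '' Set.Icc 0 (γ n)) := by
      ext w
      simp only [hCdef, Set.mem_ofPred_eq, Set.mem_inter_iff, SetLike.mem_coe, Set.mem_iInter,
        Set.mem_preimage, Set.mem_image, Set.mem_Icc, and_assoc, eq_comm]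
    rw [hCeq]
    refine (Submodule.isClosed_topologicalClosure _).inter (isClosed_iInter fun n => ?_)
    exact ((isCompact_Icc.image RCLike.continuous_ofReal).isClosed).preimage (f n).continuous
  have hbdd : Bornology.IsBounded C := by
    refine (Metric.isBounded_iff_subset_closedBall 0).2 ⟨3, fun w hw => ?_⟩
    rw [mem_closedBall_zero_iff]
    refine hx.norm_le_of_forall_norm_apply_le hδ2 hf hw.1 (by norm_num) fun k => ?_
    obtain ⟨t, ht0, ht, hft⟩ := hw.2 k
    rw [hft, RCLike.norm_of_nonneg ht0]
    nlinarith [hδ k, (hγ k).2]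
  have hreal : ∀ (a : ℝ) (w : Z), a • w = (a : 𝕜) • w := fun a w =>
    RCLike.real_smul_eq_coe_smul a w
  have hconv : Convex ℝ C := by
    intro w hw v hv a b ha hb hab
    rw [hreal, hreal]
    refine ⟨W.add_mem (W.smul_mem _ hw.1) (W.smul_mem _ hv.1), fun n => ?_⟩
    obtain ⟨t, ht0, ht, hft⟩ := hw.2 n
    obtain ⟨s, hs0, hs, hfs⟩ := hv.2 n
    refine ⟨a * t + b * s, by positivity, ?_, by
      rw [map_add, map_smul, map_smul, hft, hfs]; push_cast; rfl⟩
    calc a * t + b * s ≤ a * γ n + b * γ n := by gcongr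
      _ = γ n := by rw [← add_mul, hab, one_mul]
  set q : ℕ → ℝ := fun n => γ (n + 1) / γ n with hqdef
  have hq0 : ∀ n, 0 < q n := fun n => div_pos (hγpos _) (hγpos _)
  have hq2 : ∀ n, q n ≤ 2 := fun n =>
    (div_le_iff₀ (hγpos n)).2 (by linarith [(hγ n).1, (hγ (n + 1)).2])
  have hqγ : ∀ n, q n * γ n = γ (n + 1) := fun n => div_mul_cancel₀ _ (hγpos n).ne'
  have hqδ : ∀ n, (1 + δ (n + 1)) * q n < 1 - δ n := fun n => by
    rw [hqdef, ← mul_div_assoc, div_lt_iff₀ (hγpos n)]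
    exact hδγ n
  -- The element with the shifted and rescaled coordinates.
  have hshift : ∀ w ∈ W, ∃ v ∈ W, f 0 v = (γ 0 : ℝ) ∧ ∀ n, f (n + 1) v = (q n : 𝕜) * f n w := by
    intro w hw
    let α : ℕ → 𝕜 := fun n => Nat.casesOn n (γ 0 : 𝕜) fun n => (q n : 𝕜) * f n w
    have hα : Tendsto α atTop (𝓝 0) := by
      refine (tendsto_add_atTop_iff_nat 1).1 ?_
      have hlim := (hx.tendsto_apply hδ2 hf hw).norm.const_mul 2
      rw [norm_zero, mul_zero] at hlim
      refine squeeze_zero_norm (fun n => ?_) hlim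
      change ‖(q n : 𝕜) * f n w‖ ≤ _
      rw [norm_mul, RCLike.norm_of_nonneg (hq0 n).le]
      gcongr
      exact hq2 n
    obtain ⟨v, hv, hfv⟩ := hx.exists_forall_apply_eq hδ2 hf hα
    exact ⟨v, hv, hfv 0, fun n => hfv (n + 1)⟩
  choose! T hTW hT0 hTs using hshift
  have hTC : ∀ w ∈ C, T w ∈ C := by
    intro w hw
    refine ⟨hTW w hw.1, fun n => ?_⟩
    cases n with
    | zero => exact ⟨γ 0, (hγpos 0).le, le_rfl, hT0 w hw.1⟩
    | succ n =>
      obtain ⟨t, ht0, ht, hft⟩ := hw.2 n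
      refine ⟨q n * t, mul_nonneg (hq0 n).le ht0, ?_, ?_⟩
      · rw [← hqγ n]
        exact mul_le_mul_of_nonneg_left ht (hq0 n).le
      · rw [hTs w hw.1, hft]
        push_cast
        rfl
  intro hFPP
  obtain ⟨⟨w, hwC⟩, hw⟩ := hFPP C hne hclosed hbdd hconv (fun w => ⟨T w, hTC w w.2⟩) (by
    rintro ⟨w, hw⟩ ⟨v, hv⟩ hwv
    have hd : 0 < ‖w - v‖ := norm_pos_iff.2 (sub_ne_zero.2 fun h => hwv (Subtype.ext h))
    have hsW : w - v ∈ W := W.sub_mem hw.1 hv.1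
    set a : ℕ → ℝ := fun n => (1 + δ (n + 1)) * q n * ‖f n (w - v)‖ with hadef
    have ha : Tendsto a atTop (𝓝 0) := by
      have hlim := (hx.tendsto_apply hδ2 hf hsW).norm
      rw [norm_zero] at hlim
      refine squeeze_zero (fun n => ?_) (fun n => ?_) hlim
      · have := (hδ (n + 1)).1
        have := hq0 n
        positivity
      · exact mul_le_of_le_one_left (norm_nonneg _) ((hqδ n).le.trans (by linarith [(hδ n).1]))
    have had : ∀ n, a n < ‖w - v‖ := by
      intro n
      rcases (norm_nonneg (f n (w - v))).eq_or_lt with h | h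
      · simp only [hadef, ← h, mul_zero]
        exact hd
      · exact (mul_lt_mul_of_pos_right (hqδ n) h).trans_le (hx.norm_apply_le hf hsW n)
    obtain ⟨M, hM0, hMd, haM⟩ := exists_lt_forall_le_of_tendsto_zero ha hd had
    refine lt_of_le_of_lt ?_ hMd
    refine hx.norm_le_of_forall_norm_apply_le hδ2 hf
      (W.sub_mem (hTW w hw.1) (hTW v hv.1)) hM0 fun k => ?_
    cases k with
    | zero => rw [map_sub, hT0 w hw.1, hT0 v hv.1, sub_self, norm_zero, mul_zero]; exact hM0
    | succ n =>
      rw [map_sub, hTs w hw.1, hTs v hv.1, ← mul_sub, ← map_sub, norm_mul,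
        RCLike.norm_of_nonneg (hq0 n).le, ← mul_assoc]
      exact haM n)
  have hTw : T w = w := congrArg Subtype.val hw
  have hcoord : ∀ n, f n w = (γ n : ℝ) := by
    intro n
    induction n with
    | zero => rw [← hT0 w hwC.1, hTw]
    | succ n ih =>
      have h := hTs w hwC.1 n
      rw [hTw, ih] at h
      rw [h, ← RCLike.ofReal_mul, hqγ]
  have hlim := (hx.tendsto_apply hδ2 hf hwC.1).norm
  rw [norm_zero] at hlim
  refine absurd (ge_of_tendsto hlim (Eventually.of_forall fun n => ?_)) (not_le.2 zero_lt_one)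
  rw [hcoord, RCLike.norm_of_nonneg (hγpos n).le]
  exact (hγ n).1

end FixedPoints

/-! ### Nonreflexive subspaces of M-embedded spaces -/

/-- The real structure of `E` is the one underlying its `𝕜`-structure (`IsScalarTower ℝ 𝕜 E`);
it is only used for convexity. -/
theorem mainTheorem5 {𝕜 : Type*} [RCLike 𝕜] {E : Type*} [NormedAddCommGroup E] [NormedSpace 𝕜 E]
    [NormedSpace ℝ E] [IsScalarTower ℝ 𝕜 E] [CompleteSpace E] (hE : IsMEmbedded 𝕜 E)
    (Y : Submodule 𝕜 E) (hY : IsClosed (Y : Set E)) (hYr : ¬ IsReflexiveSpace 𝕜 Y) :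
    ContainsAsymptoticC0Copy 𝕜 Y ∧ ¬ HasFixedPointProperty Y := by
  have : CompleteSpace Y := hY.completeSpace_coe
  set p : ℕ → ℝ := fun n => (1 / 2) ^ n with hpdef
  have hp : ∀ n, 0 < p n ∧ p n ≤ 1 ∧ p (n + 1) = p n / 2 := fun n =>
    ⟨by positivity, pow_le_one₀ (by norm_num) (by norm_num), by
      rw [hpdef]; ring⟩
  have hp0 : Tendsto p atTop (𝓝 0) :=
    tendsto_pow_atTop_nhds_zero_of_lt_one (by norm_num) (by norm_num)
  -- Below, `δ` is small in comparison with the increments of `γ n = 1 + p n`.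
  set δ : ℕ → ℝ := fun n => p n ^ 2 / 64 with hδdef
  have hδ : ∀ n, 0 ≤ δ n ∧ δ n ≤ 1 / 2 := fun n => by
    obtain ⟨h0, h1, -⟩ := hp n
    exact ⟨by positivity, by simp only [hδdef]; nlinarith⟩
  have hδanti : StrictAnti δ := strictAnti_nat_of_succ_lt fun n => by
    obtain ⟨h0, h1, h2⟩ := hp n
    simp only [hδdef, h2]
    nlinarith
  have hδ0 : Tendsto δ atTop (𝓝 0) := by
    simpa using (hp0.pow 2).div_const 64
  obtain ⟨x, hx⟩ := (hE.hasCanonicalLDecomposition.submodule Y).exists_hasC0Estimates hYr hδanti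
    (fun n => (hδ n).1) (fun n => (hδ n).2.trans_lt one_half_lt_one)
  constructor
  · have hxE : HasC0Estimates 𝕜 δ fun n => (x n : E) := hasC0Estimates_coe_iff.2 hx
    refine ⟨_, ?_, Submodule.isClosed_topologicalClosure _,
      hxE.isAsymptoticallyIsometricToC0 hδ hδ0⟩
    refine Submodule.topologicalClosure_minimal _ (Submodule.span_le.2 ?_) hY
    rintro _ ⟨n, rfl⟩
    exact (x n).2
  · refine hx.not_hasFixedPointProperty (γ := fun n => 1 + p n) hδ (fun n => ?_) fun n => ?_
    · obtain ⟨h0, h1, -⟩ := hp n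
      exact ⟨by linarith, by linarith⟩
    · obtain ⟨h0, h1, h2⟩ := hp n
      simp only [hδdef, h2]
      nlinarith [mul_pos h0 h0, mul_pos (mul_pos h0 h0) h0]
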